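/- All Hilbert spaces are finite-dimensional and complex; a density matrix is a positive semidefinite matrix of trace one, and a channel is a completely positive trace-preserving linear map between matrix algebras (input and output dimensions may differ). For a channel $\Omega$ and a density matrix $\rho$ on its input space put $$S_{\rm av}(\Omega;\rho)=\inf\Big\{\sum_k p_k\,S(\Omega(\rho_k)) \;:\; \sum_k p_k\rho_k=\rho\Big\},$$ where the infimum is over all finite ensembles $\{p_k,\rho_k\}$ of density matrices $\rho_k$ with probabilities $p_k\ge 0$, $\sum_k p_k=1$, and $S(\sigma)=-\operatorname{Tr}\sigma\log\sigma$ is the von Neumann entropy. Let $\Phi$ be an entanglement-breaking channel, i.e. $\Phi(\rho)=\sum_{k=1}^K R_k\operatorname{Tr}(X_k\rho)$ with density matrices $R_k$ and a POVM $\{X_k\}$ ($X_k\ge 0$, $\sum_k X_k=I$), and let $\Omega$ be an arbitrary channel. Then for every bipartite density matrix $\tau_{12}$ on the tensor product of the input spaces of $\Phi$ and $\Omega$, with reduced density matrices $\tau_1=\operatorname{Tr}_2\tau_{12}$ and $\tau_2=\operatorname{Tr}_1\tau_{12}$, $$S_{\rm av}(\Phi\otimes\Omega;\tau_{12})\;\ge\;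 S_{\rm av}(\Phi;\tau_1)+S_{\rm av}(\Omega;\tau_2).$$ -/

import Mathlib

open scoped Kronecker ComplexOrder

noncomputable section

/-- Density matrices: positive semidefinite with trace one. -/
def IsDensityMatrix {A : Type*} [Fintype A] (ρ : Matrix A A ℂ) : Prop :=
  ρ.PosSemidef ∧ ρ.trace = 1

/-- The partial trace over the second factor, `Tr₂`. -/
def partialTraceRight {A B : Type*} [Fintype B]
    (τ : Matrix (A × B) (A × B) ℂ) : Matrix A A ℂ :=
  Matrix.of fun i i' => ∑ j, τ (i, j) (i', j)

/-- The partial trace over the first factor, `Tr₁`. -/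
def partialTraceLeft {A B : Type*} [Fintype A]
    (τ : Matrix (A × B) (A × B) ℂ) : Matrix B B ℂ :=
  Matrix.of fun j j' => ∑ i, τ (i, j) (i, j')

/-- The tensor product `Φ ⊗ Ω` of two linear maps between matrix algebras, as a map between the
matrix algebras over the product index types. -/
def tensorMap {A A' B B' : Type*} [Fintype A] [DecidableEq A] [Fintype B] [DecidableEq B]
    (Φ : Matrix A A ℂ →ₗ[ℂ] Matrix A' A' ℂ) (Ω : Matrix B B ℂ →ₗ[ℂ] Matrix B' B' ℂ) :
    Matrix (A × B) (A × B) ℂ →ₗ[ℂ] Matrix (A' × B') (A' × B') ℂ where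
  toFun τ := ∑ i, ∑ i', ∑ j, ∑ j', τ (i, j) (i', j') •
    (Φ (Matrix.single i i' 1) ⊗ₖ Ω (Matrix.single j j' 1))
  map_add' τ σ := by
    simp only [Matrix.add_apply, add_smul, Finset.sum_add_distrib]
  map_smul' c τ := by
    simp only [Matrix.smul_apply, smul_eq_mul, mul_smul, Finset.smul_sum, RingHom.id_apply]

/-- The defining property of `Φ ⊗ Ω`. -/
theorem tensorMap_kronecker {A A' B B' : Type*} [Fintype A] [DecidableEq A] [Fintype B]
    [DecidableEq B] (Φ : Matrix A A ℂ →ₗ[ℂ] Matrix A' A' ℂ)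
    (Ω : Matrix B B ℂ →ₗ[ℂ] Matrix B' B' ℂ) (X : Matrix A A ℂ) (Y : Matrix B B ℂ) :
    tensorMap Φ Ω (X ⊗ₖ Y) = Φ X ⊗ₖ Ω Y := by
  ext ⟨a, b⟩ ⟨a', b'⟩
  have hY : Ω Y = ∑ j, ∑ j', Y j j' • Ω (Matrix.single j j' 1) := by
    conv_lhs => rw [Matrix.matrix_eq_sum_single Y]
    simp only [map_sum, ← map_smul, Matrix.smul_single, smul_eq_mul, mul_one]
  have hX : Φ X = ∑ i, ∑ i', X i i' • Φ (Matrix.single i i' 1) := by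
    conv_lhs => rw [Matrix.matrix_eq_sum_single X]
    simp only [map_sum, ← map_smul, Matrix.smul_single, smul_eq_mul, mul_one]
  rw [hX, hY]
  simp only [tensorMap, LinearMap.coe_mk, AddHom.coe_mk, Matrix.kroneckerMap_apply,
    Matrix.sum_apply, Matrix.smul_apply, smul_eq_mul]
  rw [Finset.sum_mul]
  refine Finset.sum_congr rfl fun i _ => ?_
  rw [Finset.sum_mul]
  refine Finset.sum_congr rfl fun i' _ => ?_
  rw [Finset.mul_sum]
  refine Finset.sum_congr rfl fun j _ => ?_
  rw [Finset.mul_sum]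
  refine Finset.sum_congr rfl fun j' _ => ?_
  ring

/-- Complete positivity: `id ⊗ Ω` preserves positive semidefiniteness for every ancilla
dimension `n`. -/
def IsCompletelyPositive {B B' : Type*} [Fintype B] [DecidableEq B]
    (Ω : Matrix B B ℂ →ₗ[ℂ] Matrix B' B' ℂ) : Prop :=
  ∀ (n : ℕ) (τ : Matrix (Fin n × B) (Fin n × B) ℂ), τ.PosSemidef →
    (tensorMap (LinearMap.id : Matrix (Fin n) (Fin n) ℂ →ₗ[ℂ] Matrix (Fin n) (Fin n) ℂ)
      Ω τ).PosSemidef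

/-- Quantum channels: completely positive trace-preserving linear maps. -/
def IsChannel {B B' : Type*} [Fintype B] [DecidableEq B] [Fintype B']
    (Ω : Matrix B B ℂ →ₗ[ℂ] Matrix B' B' ℂ) : Prop :=
  IsCompletelyPositive Ω ∧ ∀ X : Matrix B B ℂ, (Ω X).trace = X.trace

/-- Entanglement-breaking channels: `Φ(ρ) = ∑ₖ Rₖ Tr(Xₖ ρ)` with density matrices `Rₖ` and a
POVM `{Xₖ}`. -/
def IsEntanglementBreaking {A A' : Type*} [Fintype A] [DecidableEq A] [Fintype A']
    (Φ : Matrix A A ℂ →ₗ[ℂ] Matrix A' A' ℂ) : Prop :=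
  ∃ (K : ℕ) (R : Fin K → Matrix A' A' ℂ) (X : Fin K → Matrix A A ℂ),
    (∀ k, IsDensityMatrix (R k)) ∧ (∀ k, (X k).PosSemidef) ∧ ∑ k, X k = 1 ∧
      ∀ ρ : Matrix A A ℂ, Φ ρ = ∑ k, (X k * ρ).trace • R k

/-- The von Neumann entropy `S(ρ) = -Tr ρ log ρ`, i.e. the trace of `η(ρ)` with
`η(x) = -x log x`, `η(0) = 0`, applied by functional calculus. -/
def vonNeumannEntropy {A : Type*} [Fintype A] [DecidableEq A] (ρ : Matrix A A ℂ) : ℝ :=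
  (cfc Real.negMulLog ρ).trace.re

/-- `S_av(Ω; ρ)`: the infimum of `∑ₖ pₖ S(Ω(ρₖ))` over all finite ensembles `{pₖ, ρₖ}` of density
matrices with average `∑ₖ pₖ ρₖ = ρ`. For a channel `Ω` and a density matrix `ρ` the set is
nonempty (it contains `S(Ω(ρ))`) and bounded below by `0`. -/
def minAverageEntropy {A A' : Type*} [Fintype A] [Fintype A'] [DecidableEq A']
    (Ω : Matrix A A ℂ →ₗ[ℂ] Matrix A' A' ℂ) (ρ : Matrix A A ℂ) : ℝ :=
  sInf {s : ℝ | ∃ (n : ℕ) (p : Fin n → ℝ) (σ : Fin n → Matrix A A ℂ),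
    (∀ k, 0 ≤ p k) ∧ ∑ k, p k = 1 ∧ (∀ k, IsDensityMatrix (σ k)) ∧
      ∑ k, (p k : ℂ) • σ k = ρ ∧ s = ∑ k, p k * vonNeumannEntropy (Ω (σ k))}

end

open Matrix

/-! Measuring the first factor with the POVM turns the output of `Φ ⊗ Ω` into `∑ R_k ⊗ Ω(Y_k)` with
`Y_k = Tr₁((X_k ⊗ 1)τ) = q_k σ_k`. Since `∑ Y_k = Tr₁ τ`, the pairs `(q_k, σ_k)` are an ensemble for
the second marginal. Everything thus rests on `S(∑ q_k R_k ⊗ ω_k) ≥ S(∑ q_k R_k) + ∑ q_k S(ω_k)`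
(`vonNeumannEntropy_sum_kronecker_ge`), applied to each member of an ensemble for `τ`.

This entropy inequality is derived from operator concavity of the logarithm. Splitting the `R_k`
into rank-one terms `a aᴴ`, let `M` be the mixture, `N = Tr₂ M`, `ω = ∑ l_j w_j w_jᴴ` and `V_j z = z
⊗ w_j`. If all `l_j > 0`, then `∑ l_j V_jᴴ (M / l_j) V_j = N`, so Jensen gives `∑ l_j V_jᴴ log(M /
l_j) V_j ≤ log N`. Evaluating at `a` and summing over the rank-one terms gives the claim. Jensen
itself is proved for resolvents by a variational bound (`mul_two_re_sub_le`) and passed to the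
logarithm by `sum_mul_log_le_of_sum_div_le`. -/

/-! ### From resolvents to logarithms. -/

theorem tendsto_log_add_sub_log_atTop (x : ℝ) :
    Filter.Tendsto (fun s : ℝ => Real.log (x + s) - Real.log s) Filter.atTop (nhds 0) := by
  have h1 : Filter.Tendsto (fun s : ℝ => x / s + 1) Filter.atTop (nhds 1) := by
    simpa using (Filter.tendsto_id.const_div_atTop x).add_const 1
  have h2 := (Real.continuousAt_log one_ne_zero).tendsto.comp h1
  rw [Real.log_one] at h2
  refine h2.congr' ?_
  filter_upwards [Filter.eventually_gt_atTop 0, Filter.eventually_gt_atTop (-x)] with s hs hx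
  rw [Function.comp_apply, ← Real.log_div (by linarith) hs.ne']
  congr 1
  field_simp

/-- Comparison of weighted resolvents at all `s > 0` implies comparison of weighted logarithms. -/
theorem sum_mul_log_le_of_sum_div_le {ι κ : Type*} [Fintype ι] [Fintype κ]
    (p x : ι → ℝ) (q y : κ → ℝ) (hx : ∀ i, 0 ≤ x i) (hy : ∀ i, 0 ≤ y i)
    (hpx : ∀ i, x i = 0 → p i = 0) (hqy : ∀ i, y i = 0 → q i = 0)
    (hpq : ∑ i, p i = ∑ i, q i)
    (h : ∀ s : ℝ, 0 < s → ∑ i, q i / (y i + s) ≤ ∑ i, p i / (x i + s)) :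
    ∑ i, p i * Real.log (x i) ≤ ∑ i, q i * Real.log (y i) := by
  -- The resolvent hypothesis says exactly that `g' ≤ 0`. As `g` vanishes at infinity, `g ≥ 0`, and
  -- the claim is the limit at `0`.
  set g : ℝ → ℝ := fun s => ∑ i, q i * Real.log (y i + s) - ∑ i, p i * Real.log (x i + s) with hg
  have hd : ∀ s ∈ Set.Ioi (0 : ℝ), HasDerivAt g
      (∑ i, q i * (1 / (y i + s)) - ∑ i, p i * (1 / (x i + s))) s := by
    intro s hs
    have hs : 0 < s := hs
    refine HasDerivAt.sub (HasDerivAt.fun_sum fun i _ => ?_) (HasDerivAt.fun_sum fun i _ => ?_)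
    · exact (((hasDerivAt_id s).const_add (y i)).log (by have := hy i; simp; linarith)).const_mul _
    · exact (((hasDerivAt_id s).const_add (x i)).log (by have := hx i; simp; linarith)).const_mul _
  have hanti : AntitoneOn g (Set.Ioi 0) := by
    refine antitoneOn_of_deriv_nonpos (convex_Ioi 0)
      (fun s hs => (hd s hs).continuousAt.continuousWithinAt) ?_ ?_
    · rw [interior_Ioi]
      exact fun s hs => (hd s hs).differentiableAt.differentiableWithinAt
    · rw [interior_Ioi]
      intro s hs
      rw [(hd s hs).deriv]
      have := h s hs
      simp only [mul_one_div]
      linarith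
  have hlim : Filter.Tendsto g Filter.atTop (nhds 0) := by
    -- Equal total weights make the subtracted `log s` terms cancel.
    have h1 : Filter.Tendsto (fun s : ℝ => ∑ i, q i * (Real.log (y i + s) - Real.log s)
        - ∑ i, p i * (Real.log (x i + s) - Real.log s)) Filter.atTop (nhds 0) := by
      have := (tendsto_finsetSum Finset.univ fun i _ =>
        (tendsto_log_add_sub_log_atTop (y i)).const_mul (q i)).sub
        (tendsto_finsetSum Finset.univ fun i _ =>
        (tendsto_log_add_sub_log_atTop (x i)).const_mul (p i))
      simpa using this
    refine h1.congr fun s => ?_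
    simp only [hg, mul_sub, Finset.sum_sub_distrib, ← Finset.sum_mul, hpq]
    ring
  have hnonneg : ∀ s ∈ Set.Ioi (0 : ℝ), 0 ≤ g s := by
    intro s hs
    refine le_of_tendsto hlim ?_
    filter_upwards [Filter.eventually_ge_atTop s] with t ht
    exact hanti hs (lt_of_lt_of_le hs ht) ht
  -- At `v = 0` the logarithm diverges as `s → 0`, but its coefficient vanishes there.
  have key : ∀ c v : ℝ, 0 ≤ v → (v = 0 → c = 0) →
      Filter.Tendsto (fun s => c * Real.log (v + s)) (nhdsWithin 0 (Set.Ioi 0))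
        (nhds (c * Real.log v)) := by
    intro c v _ hc
    by_cases hv0 : v = 0
    · simp [hc hv0]
    · have : ContinuousAt (fun s => c * Real.log (v + s)) 0 :=
        ((continuousAt_const.add continuousAt_id).log (by simpa using hv0)).const_mul c
      simpa using this.tendsto.mono_left nhdsWithin_le_nhds
  have hz : Filter.Tendsto g (nhdsWithin 0 (Set.Ioi 0))
      (nhds (∑ i, q i * Real.log (y i) - ∑ i, p i * Real.log (x i))) :=
    (tendsto_finsetSum Finset.univ fun i _ => key _ _ (hy i) (hqy i)).sub
      (tendsto_finsetSum Finset.univ fun i _ => key _ _ (hx i) (hpx i))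
  have := ge_of_tendsto hz (Filter.eventually_of_mem self_mem_nhdsWithin hnonneg)
  linarith


/-! ### Spectral data and tensor columns. -/

theorem Matrix.PosSemidef.exists_spectral_decomposition {n : Type*} [Fintype n] [DecidableEq n]
    {M : Matrix n n ℂ} (hM : M.PosSemidef) :
    ∃ (m : n → ℝ) (U : Matrix n n ℂ), U * Uᴴ = 1 ∧ Uᴴ * U = 1 ∧ (∀ x, 0 ≤ m x) ∧
      M = U * diagonal (fun x => (m x : ℂ)) * Uᴴ ∧
      vonNeumannEntropy M = ∑ x, Real.negMulLog (m x) := by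
  refine ⟨hM.1.eigenvalues, hM.1.eigenvectorUnitary, ?_, ?_, hM.eigenvalues_nonneg, ?_, ?_⟩
  · exact Unitary.mul_star_self_of_mem hM.1.eigenvectorUnitary.2
  · exact Unitary.star_mul_self_of_mem hM.1.eigenvectorUnitary.2
  · exact hM.1.spectral_theorem
  · rw [vonNeumannEntropy, hM.1.cfc_eq, Matrix.IsHermitian.cfc, Unitary.conjStarAlgAut_apply,
      trace_mul_cycle, Unitary.coe_star_mul_self, one_mul, trace_diagonal]
    simp

/-- The matrix with columns `a ⊗ w`, where `w` runs over the columns of `W`. -/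
def tensorCols {A B J : Type*} (a : A → ℂ) (W : Matrix B J ℂ) : Matrix (A × B) J ℂ :=
  Matrix.of fun p j => a p.1 * W p.2 j

theorem tensorCols_conjTranspose_mul {A B J : Type*} [Fintype A] [Fintype B]
    (z a : A → ℂ) (W : Matrix B J ℂ) :
    (tensorCols z W)ᴴ * tensorCols a W = (star z ⬝ᵥ a) • (Wᴴ * W) := by
  ext i j
  simp only [mul_apply, conjTranspose_apply, tensorCols, of_apply, Fintype.sum_prod_type,
    Matrix.smul_apply, dotProduct, smul_eq_mul, Finset.sum_mul_sum, Pi.star_apply, star_mul']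
  exact Finset.sum_congr rfl fun _ _ => Finset.sum_congr rfl fun _ _ => by ring

theorem tensorCols_mul_mul_conjTranspose {A B J : Type*} [Fintype J] [DecidableEq J]
    (a : A → ℂ) (W : Matrix B J ℂ) (d : J → ℂ) :
    tensorCols a W * diagonal d * (tensorCols a W)ᴴ
      = vecMulVec a (star a) ⊗ₖ (W * diagonal d * Wᴴ) := by
  ext i j
  rw [mul_apply, kroneckerMap_apply, mul_apply]
  simp only [conjTranspose_apply, tensorCols, of_apply,
    vecMulVec_apply, mul_diagonal, Finset.mul_sum, Pi.star_apply, star_mul']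
  exact Finset.sum_congr rfl fun _ _ => by ring

theorem trace_tensorCols {A B : Type*} [Fintype A] [Fintype B] [DecidableEq B]
    (z : A → ℂ) {W : Matrix B B ℂ} (hW : W * Wᴴ = 1) (σ : Matrix (A × B) (A × B) ℂ) :
    ((tensorCols z W)ᴴ * σ * tensorCols z W).trace
      = star z ⬝ᵥ (partialTraceRight σ *ᵥ z) := by
  -- With unit weights this reads `∑ (z ⊗ w_j)(z ⊗ w_j)ᴴ = z zᴴ ⊗ 1`.
  have h := tensorCols_mul_mul_conjTranspose z W 1
  rw [diagonal_one', Matrix.mul_one, Matrix.mul_one, hW] at h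
  rw [Matrix.mul_assoc, trace_mul_comm, Matrix.mul_assoc, h]
  simp only [trace, diag_apply, mul_apply, kroneckerMap_apply, vecMulVec_apply,
    Fintype.sum_prod_type, one_apply, mul_ite, mul_one, mul_zero, Finset.sum_ite_eq',
    Finset.mem_univ, if_true, dotProduct, mulVec, partialTraceRight, of_apply, Finset.mul_sum,
    Finset.sum_mul, Pi.star_apply]
  refine Finset.sum_congr rfl fun i _ => ?_
  rw [Finset.sum_comm]
  exact Finset.sum_congr rfl fun _ _ => Finset.sum_congr rfl fun _ _ => by ring

theorem conjTranspose_mul_diagonal_mul_apply {J K : Type*} [Fintype J] [DecidableEq J]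
    (C : Matrix J K ℂ) (d : J → ℝ) (k : K) :
    (Cᴴ * diagonal (fun x => (d x : ℂ)) * C) k k = ((∑ x, d x * ‖C x k‖ ^ 2 : ℝ) : ℂ) := by
  rw [mul_apply]
  simp only [mul_diagonal, conjTranspose_apply]
  push_cast
  refine Finset.sum_congr rfl fun x _ => ?_
  rw [← Complex.conj_mul']
  simp only [RCLike.star_def]
  ring

/-! ### Operator Jensen inequality in spectral coordinates. -/

/-- With `k = m / l`, this is `‖q - (k + s) p‖² ≥ 0` rearranged and scaled by `l`. For `l = 0` the
right side is `0` and the left is `-m ‖p‖²`. -/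
theorem mul_two_re_sub_le (l m s : ℝ) (hl : 0 ≤ l) (hm : 0 ≤ m) (hs : 0 < s) (p q : ℂ) :
    l * (2 * (star p * q).re) - m * ‖p‖ ^ 2 - s * (l * ‖p‖ ^ 2) ≤ l * ‖q‖ ^ 2 / (m / l + s) := by
  rcases hl.eq_or_lt with rfl | hl
  · simp; positivity
  · have hk : 0 < m / l + s := by positivity
    rw [le_div_iff₀ hk]
    have h1 : m = l * (m / l) := by field_simp
    generalize m / l = k at *
    subst h1
    have h2 : 0 ≤ ‖q - ((k + s : ℝ) : ℂ) * p‖ ^ 2 := by positivity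
    rw [Complex.sq_norm, Complex.normSq_apply] at h2 ⊢
    rw [Complex.sq_norm, Complex.normSq_apply]
    simp only [RCLike.star_def, Complex.mul_re, Complex.conj_re, Complex.conj_im, Complex.sub_re,
      Complex.sub_im, Complex.ofReal_re, Complex.ofReal_im, Complex.mul_im] at h2 ⊢
    nlinarith [mul_nonneg hl.le h2]

theorem star_conjTranspose_mulVec_dotProduct {n : Type*} [Fintype n] [DecidableEq n]
    {V : Matrix n n ℂ} (hV : V * Vᴴ = 1) (z a : n → ℂ) :
    star (Vᴴ *ᵥ z) ⬝ᵥ (Vᴴ *ᵥ a) = star z ⬝ᵥ a := by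
  rw [star_mulVec, conjTranspose_conjTranspose, dotProduct_mulVec, vecMul_vecMul, hV, vecMul_one]

theorem star_dotProduct_diagonal_conj_mulVec {n : Type*} [Fintype n] [DecidableEq n]
    (V : Matrix n n ℂ) (d : n → ℝ) (z : n → ℂ) :
    star z ⬝ᵥ ((V * diagonal (fun y => (d y : ℂ)) * Vᴴ) *ᵥ z)
      = ((∑ y, d y * ‖(Vᴴ *ᵥ z) y‖ ^ 2 : ℝ) : ℂ) := by
  rw [← mulVec_mulVec, ← mulVec_mulVec, dotProduct_mulVec, ← conjTranspose_conjTranspose V,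
    ← star_mulVec, conjTranspose_conjTranspose]
  simp only [dotProduct, mulVec_diagonal, Pi.star_apply]
  push_cast
  refine Finset.sum_congr rfl fun x _ => ?_
  rw [← Complex.conj_mul']
  simp only [RCLike.star_def]
  ring

theorem star_dotProduct_self_eq_sum_sq {n : Type*} [Fintype n] (z : n → ℂ) :
    star z ⬝ᵥ z = ((∑ y, ‖z y‖ ^ 2 : ℝ) : ℂ) := by
  simp only [dotProduct, Pi.star_apply]
  push_cast
  exact Finset.sum_congr rfl fun x _ => by rw [← Complex.conj_mul']; rfl

/-- The resolvent form of the operator Jensen inequality for the isometries `z ↦ z ⊗ w`, with `w`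
running over the columns of `W`. -/
theorem sum_div_add_le_sum_div_add {A B : Type*} [Fintype A] [DecidableEq A] [Fintype B]
    [DecidableEq B] {σ : Matrix (A × B) (A × B) ℂ} (a : A → ℂ)
    {m : A × B → ℝ} {U : Matrix (A × B) (A × B) ℂ} (hU : U * Uᴴ = 1) (hm : ∀ x, 0 ≤ m x)
    (hσ : σ = U * diagonal (fun x => (m x : ℂ)) * Uᴴ)
    {n : A → ℝ} {V : Matrix A A ℂ} (hV : V * Vᴴ = 1) (hV' : Vᴴ * V = 1) (hn : ∀ y, 0 ≤ n y)
    (hN : partialTraceRight σ = V * diagonal (fun y => (n y : ℂ)) * Vᴴ)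
    {l : B → ℝ} {W : Matrix B B ℂ} (hW : W * Wᴴ = 1) (hW' : Wᴴ * W = 1) (hl : ∀ j, 0 ≤ l j)
    (hl1 : ∑ j, l j = 1) {s : ℝ} (hs : 0 < s) :
    ∑ y, ‖(Vᴴ *ᵥ a) y‖ ^ 2 / (n y + s) ≤
      ∑ x : (A × B) × B, l x.2 * ‖(Uᴴ * tensorCols a W) x.1 x.2‖ ^ 2 / (m x.1 / l x.2 + s) := by
  set v := Vᴴ *ᵥ a with hv
  -- The optimal trial vector `(N + s)⁻¹ a`, used for every `j`.
  set z := V *ᵥ (fun y => v y / ((n y + s : ℝ) : ℂ)) with hz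
  have hVz : Vᴴ *ᵥ z = fun y => v y / ((n y + s : ℝ) : ℂ) := by
    rw [hz, mulVec_mulVec, hV', one_mulVec]
  set P := Uᴴ * tensorCols z W with hP
  set Q := Uᴴ * tensorCols a W with hQ
  have hgram : ∀ b c : A → ℂ, ∀ j,
      ∑ x, star ((Uᴴ * tensorCols b W) x j) * (Uᴴ * tensorCols c W) x j = star b ⬝ᵥ c := by
    intro b c j
    have h : (Uᴴ * tensorCols b W)ᴴ * (Uᴴ * tensorCols c W) = (star b ⬝ᵥ c) • 1 := by
      rw [conjTranspose_mul, conjTranspose_conjTranspose, Matrix.mul_assoc, ← Matrix.mul_assoc U,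
        hU, Matrix.one_mul, tensorCols_conjTranspose_mul, hW']
    have := congrFun (congrFun h j) j
    rw [mul_apply] at this
    simpa only [conjTranspose_apply, Matrix.smul_apply, one_apply_eq, smul_eq_mul, mul_one] using
      this
  -- Summing the quadratic form of `σ` over the orthonormal basis `w_j` yields that of `Tr₂ σ`.
  have hquad : ∑ j, ∑ x, m x * ‖P x j‖ ^ 2 = ∑ y, n y * ‖(Vᴴ *ᵥ z) y‖ ^ 2 := by
    have h := trace_tensorCols z hW σ
    rw [hN, star_dotProduct_diagonal_conj_mulVec, hσ] at h
    have h' : (tensorCols z W)ᴴ * (U * diagonal (fun x => (m x : ℂ)) * Uᴴ) * tensorCols z W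
        = Pᴴ * diagonal (fun x => (m x : ℂ)) * P := by
      simp only [hP, conjTranspose_mul, conjTranspose_conjTranspose, Matrix.mul_assoc]
    rw [h', trace] at h
    simp only [diag_apply, conjTranspose_mul_diagonal_mul_apply] at h
    exact_mod_cast h
  have hcross : ∀ j, ∑ x, (star (P x j) * Q x j).re = ∑ y, ‖v y‖ ^ 2 / (n y + s) := by
    intro j
    rw [← Complex.re_sum, hgram z a j, ← star_conjTranspose_mulVec_dotProduct hV, hVz, ← hv,
      dotProduct, Complex.re_sum]
    refine Finset.sum_congr rfl fun y _ => ?_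
    simp only [Pi.star_apply, star_div₀, RCLike.star_def, Complex.conj_ofReal]
    rw [div_mul_eq_mul_div, Complex.conj_mul']
    norm_cast
  have hnorm : ∀ j, ∑ x, ‖P x j‖ ^ 2 = ∑ y, ‖(Vᴴ *ᵥ z) y‖ ^ 2 := by
    intro j
    have h := hgram z z j
    rw [← star_conjTranspose_mulVec_dotProduct hV, star_dotProduct_self_eq_sum_sq] at h
    have h2 : ∑ x, star (P x j) * P x j = ((∑ x, ‖P x j‖ ^ 2 : ℝ) : ℂ) :=
      star_dotProduct_self_eq_sum_sq fun x => P x j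
    rw [h2] at h
    exact_mod_cast h
  have hterm : ∀ x : (A × B) × B, _ := fun x =>
    mul_two_re_sub_le (l x.2) (m x.1) s (hl _) (hm _) hs (P x.1 x.2) (Q x.1 x.2)
  -- The lower bounds add up to `2⟨z, a⟩ - ⟨z, N z⟩ - s‖z‖²`, which is `⟨a, (N + s)⁻¹ a⟩` for this
  -- `z`.
  refine le_trans (le_of_eq ?_) (Finset.sum_le_sum fun x _ => hterm x)
  rw [Fintype.sum_prod_type_right]
  simp only [Finset.sum_sub_distrib, ← Finset.mul_sum, hcross, hnorm, hquad]
  rw [← Finset.sum_mul, ← Finset.sum_mul, hl1, one_mul, one_mul, hVz, Finset.mul_sum,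
    Finset.mul_sum, ← Finset.sum_sub_distrib, ← Finset.sum_sub_distrib]
  refine Finset.sum_congr rfl fun y _ => ?_
  have : 0 < n y + s := by linarith [hn y]
  rw [norm_div, Complex.norm_real, Real.norm_of_nonneg this.le]
  field_simp
  ring

/-- A spectral form of `tr ((a aᴴ ⊗ ω) log σ) ≤ aᴴ (log (tr₂ σ)) a - ‖a‖² S(ω)`. -/
theorem sum_mul_log_le_of_partialTraceRight {A B : Type*} [Fintype A] [DecidableEq A] [Fintype B]
    [DecidableEq B] {σ : Matrix (A × B) (A × B) ℂ} (a : A → ℂ)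
    {m : A × B → ℝ} {U : Matrix (A × B) (A × B) ℂ} (hU : U * Uᴴ = 1) (hm : ∀ x, 0 ≤ m x)
    (hσ : σ = U * diagonal (fun x => (m x : ℂ)) * Uᴴ)
    {n : A → ℝ} {V : Matrix A A ℂ} (hV : V * Vᴴ = 1) (hV' : Vᴴ * V = 1) (hn : ∀ y, 0 ≤ n y)
    (hN : partialTraceRight σ = V * diagonal (fun y => (n y : ℂ)) * Vᴴ)
    {l : B → ℝ} {W : Matrix B B ℂ} (hW : W * Wᴴ = 1) (hW' : Wᴴ * W = 1) (hl : ∀ j, 0 ≤ l j)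
    (hl1 : ∑ j, l j = 1)
    (hdom : ∀ x j, l j * ‖(Uᴴ * tensorCols a W) x j‖ ^ 2 ≤ m x)
    (hdom' : ∀ y, ‖(Vᴴ *ᵥ a) y‖ ^ 2 ≤ n y) :
    ∑ x, (∑ j, l j * ‖(Uᴴ * tensorCols a W) x j‖ ^ 2) * Real.log (m x) ≤
      ∑ y, ‖(Vᴴ *ᵥ a) y‖ ^ 2 * Real.log (n y)
        + (∑ y, ‖(Vᴴ *ᵥ a) y‖ ^ 2) * ∑ j, l j * Real.log (l j) := by
  set C := Uᴴ * tensorCols a W with hC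
  have hnorm : ∀ j, ∑ x, ‖C x j‖ ^ 2 = ∑ y, ‖(Vᴴ *ᵥ a) y‖ ^ 2 := by
    intro j
    have h : Cᴴ * C = (star a ⬝ᵥ a) • 1 := by
      rw [hC, conjTranspose_mul, conjTranspose_conjTranspose, Matrix.mul_assoc,
        ← Matrix.mul_assoc U, hU, Matrix.one_mul, tensorCols_conjTranspose_mul, hW']
    have h1 : star (fun x => C x j) ⬝ᵥ (fun x => C x j) = star a ⬝ᵥ a := by
      simpa [mul_apply, dotProduct] using congrFun (congrFun h j) j
    rw [← star_conjTranspose_mulVec_dotProduct hV, star_dotProduct_self_eq_sum_sq,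
      star_dotProduct_self_eq_sum_sq] at h1
    exact_mod_cast h1
  have h := sum_mul_log_le_of_sum_div_le (fun x : (A × B) × B => l x.2 * ‖C x.1 x.2‖ ^ 2)
    (fun x => m x.1 / l x.2) (fun y => ‖(Vᴴ *ᵥ a) y‖ ^ 2) n
    (fun x => div_nonneg (hm _) (hl _)) hn
    -- The quotient vanishes if `m = 0`, where `hdom` kills the weight, or by convention if `l = 0`,
    -- where the weight is visibly zero.
    (fun x hx => by
      rcases div_eq_zero_iff.1 hx with h0 | h0
      · exact le_antisymm (h0 ▸ hdom x.1 x.2) (mul_nonneg (hl _) (by positivity))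
      · simp [h0])
    (fun y hy => le_antisymm (hy ▸ hdom' y) (by positivity))
    (by
      rw [Fintype.sum_prod_type_right]
      simp only [← Finset.mul_sum, hnorm]
      rw [← Finset.sum_mul, hl1, one_mul])
    (fun s hs => sum_div_add_le_sum_div_add a hU hm hσ hV hV' hn hN hW hW' hl hl1 hs)
  have hlog : ∀ x : (A × B) × B, l x.2 * ‖C x.1 x.2‖ ^ 2 * Real.log (m x.1 / l x.2)
      = l x.2 * ‖C x.1 x.2‖ ^ 2 * Real.log (m x.1)
        - l x.2 * Real.log (l x.2) * ‖C x.1 x.2‖ ^ 2 := by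
    intro x
    by_cases hlx : l x.2 = 0
    · simp [hlx]
    by_cases hmx : m x.1 = 0
    · have : l x.2 * ‖C x.1 x.2‖ ^ 2 = 0 :=
        le_antisymm (hmx ▸ hdom x.1 x.2) (mul_nonneg (hl _) (by positivity))
      rw [this, mul_right_comm, this]
      simp
    · rw [Real.log_div hmx hlx]
      ring
  simp only [hlog, Finset.sum_sub_distrib] at h
  have h1 : ∑ x : (A × B) × B, l x.2 * Real.log (l x.2) * ‖C x.1 x.2‖ ^ 2
      = (∑ y, ‖(Vᴴ *ᵥ a) y‖ ^ 2) * ∑ j, l j * Real.log (l j) := by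
    rw [Fintype.sum_prod_type_right]
    simp only [← Finset.mul_sum, hnorm]
    rw [← Finset.sum_mul, mul_comm]
  have h2 : ∑ x : (A × B) × B, l x.2 * ‖C x.1 x.2‖ ^ 2 * Real.log (m x.1)
      = ∑ x, (∑ j, l j * ‖C x j‖ ^ 2) * Real.log (m x) := by
    rw [Fintype.sum_prod_type]
    simp only [← Finset.sum_mul]
  linarith

/-! ### Superadditivity of entropy for separable mixtures. -/

theorem partialTraceRight_sum {A B ι : Type*} [Fintype B] (s : Finset ι)
    (τ : ι → Matrix (A × B) (A × B) ℂ) :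
    partialTraceRight (∑ k ∈ s, τ k) = ∑ k ∈ s, partialTraceRight (τ k) := by
  ext i i'
  simp only [partialTraceRight, of_apply, Matrix.sum_apply]
  exact Finset.sum_comm

theorem partialTraceRight_kronecker {A B : Type*} [Fintype B] (X : Matrix A A ℂ)
    (Y : Matrix B B ℂ) : partialTraceRight (X ⊗ₖ Y) = Y.trace • X := by
  ext i i'
  simp only [partialTraceRight, of_apply, kroneckerMap_apply, ← Finset.mul_sum,
    Matrix.smul_apply, smul_eq_mul, trace, diag_apply]
  ring

theorem sum_norm_sq_conjTranspose_mulVec {n : Type*} [Fintype n] [DecidableEq n]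
    {V : Matrix n n ℂ} (hV : V * Vᴴ = 1) (a : n → ℂ) :
    ∑ y, ‖(Vᴴ *ᵥ a) y‖ ^ 2 = ∑ y, ‖a y‖ ^ 2 := by
  have h := star_conjTranspose_mulVec_dotProduct hV a a
  rw [star_dotProduct_self_eq_sum_sq, star_dotProduct_self_eq_sum_sq] at h
  exact_mod_cast h

theorem conjTranspose_mul_conj_mul {n : Type*} [Fintype n] [DecidableEq n]
    {U M : Matrix n n ℂ} (hU : Uᴴ * U = 1) {d : n → ℂ} (hM : M = U * diagonal d * Uᴴ) :
    Uᴴ * M * U = diagonal d := by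
  rw [hM, Matrix.mul_assoc, Matrix.mul_assoc, hU, Matrix.mul_one, ← Matrix.mul_assoc, hU,
    Matrix.one_mul]

/-- Superadditivity of the entropy of a separable mixture, with pure states on the first factor. -/
theorem vonNeumannEntropy_sum_vecMulVec_kronecker_ge {A B ι : Type*} [Fintype A] [DecidableEq A]
    [Fintype B] [DecidableEq B] [Fintype ι] (a : ι → A → ℂ) (ω : ι → Matrix B B ℂ)
    (hω : ∀ c, IsDensityMatrix (ω c)) :
    vonNeumannEntropy (∑ c, vecMulVec (a c) (star (a c)))
        + ∑ c, (∑ y, ‖a c y‖ ^ 2) * vonNeumannEntropy (ω c)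
      ≤ vonNeumannEntropy (∑ c, vecMulVec (a c) (star (a c)) ⊗ₖ ω c) := by
  have hNpsd : (∑ c, vecMulVec (a c) (star (a c))).PosSemidef :=
    posSemidef_sum _ fun c _ => posSemidef_vecMulVec_self_star _
  have hMpsd : (∑ c, vecMulVec (a c) (star (a c)) ⊗ₖ ω c).PosSemidef :=
    posSemidef_sum _ fun c _ => (posSemidef_vecMulVec_self_star _).kronecker (hω c).1
  have hpt : partialTraceRight (∑ c, vecMulVec (a c) (star (a c)) ⊗ₖ ω c)
      = ∑ c, vecMulVec (a c) (star (a c)) := by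
    rw [partialTraceRight_sum]
    simp only [partialTraceRight_kronecker, (hω _).2, one_smul]
  obtain ⟨n, V, hV, hV', hn, hN, hSN⟩ := hNpsd.exists_spectral_decomposition
  obtain ⟨m, U, hU, hU', hm, hM, hSM⟩ := hMpsd.exists_spectral_decomposition
  choose l W hW hW' hl hωW hSω using fun c => (hω c).1.exists_spectral_decomposition
  have hl1 : ∀ c, ∑ j, l c j = 1 := by
    intro c
    have h := (hω c).2
    rw [hωW c, trace_mul_cycle, hW', Matrix.one_mul, trace_diagonal] at h
    exact_mod_cast h
  -- The diagonal of `Uᴴ M U`, computed from the mixture: the weights in the Jensen bounds add up to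
  -- the eigenvalues of `M`.
  have hmx : ∀ x, ∑ c, ∑ j, l c j * ‖(Uᴴ * tensorCols (a c) (W c)) x j‖ ^ 2 = m x := by
    intro x
    have h := congrFun (congrFun (conjTranspose_mul_conj_mul hU' hM) x) x
    rw [diagonal_apply_eq, Finset.mul_sum, Finset.sum_mul, Matrix.sum_apply] at h
    have hc : ∀ c, (Uᴴ * (vecMulVec (a c) (star (a c)) ⊗ₖ ω c) * U) x x
        = ((∑ j, l c j * ‖(Uᴴ * tensorCols (a c) (W c)) x j‖ ^ 2 : ℝ) : ℂ) := by
      intro c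
      have h1 : Uᴴ * (vecMulVec (a c) (star (a c)) ⊗ₖ ω c) * U
          -- The double adjoint matches the shape of `conjTranspose_mul_diagonal_mul_apply`.
          = (Uᴴ * tensorCols (a c) (W c))ᴴᴴ * diagonal (fun j => (l c j : ℂ))
            * (Uᴴ * tensorCols (a c) (W c))ᴴ := by
        rw [hωW c, ← tensorCols_mul_mul_conjTranspose]
        simp only [conjTranspose_mul, conjTranspose_conjTranspose, Matrix.mul_assoc]
      rw [h1, conjTranspose_mul_diagonal_mul_apply]
      congr 1
      refine Finset.sum_congr rfl fun j _ => ?_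
      rw [conjTranspose_apply, norm_star]
    simp only [hc] at h
    exact_mod_cast h
  have hny : ∀ y, ∑ c, ‖(Vᴴ *ᵥ a c) y‖ ^ 2 = n y := by
    intro y
    have h := congrFun (congrFun (conjTranspose_mul_conj_mul hV' hN) y) y
    rw [diagonal_apply_eq, Finset.mul_sum, Finset.sum_mul, Matrix.sum_apply] at h
    have hc : ∀ c, (Vᴴ * vecMulVec (a c) (star (a c)) * V) y y
        = ((‖(Vᴴ *ᵥ a c) y‖ ^ 2 : ℝ) : ℂ) := by
      intro c
      have h1 : star (a c) ᵥ* V = star (Vᴴ *ᵥ a c) := by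
        rw [star_mulVec, conjTranspose_conjTranspose]
      rw [mul_vecMulVec, vecMulVec_mul, h1, vecMulVec_apply, Pi.star_apply]
      push_cast
      exact Complex.mul_conj' _
    simp only [hc] at h
    exact_mod_cast h
  have hd : ∀ c x j, 0 ≤ l c j * ‖(Uᴴ * tensorCols (a c) (W c)) x j‖ ^ 2 := fun c x j =>
    mul_nonneg (hl c j) (by positivity)
  have hcore := fun c => sum_mul_log_le_of_partialTraceRight (a c) hU hm hM hV hV' hn
    (hpt.trans hN) (hW c) (hW' c) (hl c) (hl1 c)
    (fun x j => by
      rw [← hmx x]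
      exact (Finset.single_le_sum (f := fun j => l c j * ‖(Uᴴ * tensorCols (a c) (W c)) x j‖ ^ 2)
        (fun j _ => hd c x j) (Finset.mem_univ j)).trans
        (Finset.single_le_sum
          (f := fun c => ∑ j, l c j * ‖(Uᴴ * tensorCols (a c) (W c)) x j‖ ^ 2)
          (fun c _ => Finset.sum_nonneg fun j _ => hd c x j) (Finset.mem_univ c)))
    (fun y => by
      rw [← hny y]
      exact Finset.single_le_sum (f := fun c => ‖(Vᴴ *ᵥ a c) y‖ ^ 2)
        (fun c _ => by positivity) (Finset.mem_univ c))
  have hsum := Finset.sum_le_sum fun c (_ : c ∈ Finset.univ) => hcore c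
  rw [Finset.sum_comm, Finset.sum_add_distrib, 
    Finset.sum_comm (s := (Finset.univ : Finset ι)) (t := (Finset.univ : Finset A))] at hsum
  simp only [← Finset.sum_mul, hmx, hny, sum_norm_sq_conjTranspose_mulVec hV] at hsum
  rw [hSN, hSM]
  simp only [hSω, Real.negMulLog, neg_mul, Finset.sum_neg_distrib, mul_neg]
  linarith

/-- Superadditivity of the entropy of a separable mixture. -/
theorem vonNeumannEntropy_sum_kronecker_ge {A B ι : Type*} [Fintype A] [DecidableEq A]
    [Fintype B] [DecidableEq B] [Fintype ι] (R : ι → Matrix A A ℂ) (ω : ι → Matrix B B ℂ)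
    (hR : ∀ k, (R k).PosSemidef) (hω : ∀ k, IsDensityMatrix (ω k)) :
    vonNeumannEntropy (∑ k, R k) + ∑ k, (R k).trace.re * vonNeumannEntropy (ω k)
      ≤ vonNeumannEntropy (∑ k, R k ⊗ₖ ω k) := by
  choose m U _ _ hm hspec _ using fun k => (hR k).exists_spectral_decomposition
  -- Eigenvectors of `R k` scaled by square roots of eigenvalues; each is paired with the same `ω
  -- k`.
  set v : ι → A → A → ℂ := fun k i p => (√(m k i) : ℂ) * U k p i with hv
  have hdec : ∀ k, R k = ∑ i, vecMulVec (v k i) (star (v k i)) := by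
    intro k
    ext p q
    rw [hspec k, mul_apply, Matrix.sum_apply]
    refine Finset.sum_congr rfl fun i _ => ?_
    have hs : (√(m k i) : ℂ) * (√(m k i) : ℂ) = (m k i : ℂ) := by
      exact_mod_cast Real.mul_self_sqrt (hm k i)
    rw [mul_diagonal, conjTranspose_apply, vecMulVec_apply, Pi.star_apply, star_mul',
      RCLike.star_def, Complex.conj_ofReal, ← hs]
    ring
  have h := vonNeumannEntropy_sum_vecMulVec_kronecker_ge (fun c : ι × A => v c.1 c.2)
    (fun c => ω c.1) fun c => hω c.1
  simp only [Fintype.sum_prod_type, ← Finset.sum_mul] at h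
  have hk : ∀ k, ∑ i, vecMulVec (v k i) (star (v k i)) ⊗ₖ ω k = R k ⊗ₖ ω k := by
    intro k
    rw [hdec k]
    ext p q
    simp only [Matrix.sum_apply, kroneckerMap_apply, Finset.sum_mul]
  have ht : ∀ k, ∑ i, ∑ y, ‖v k i y‖ ^ 2 = (R k).trace.re := by
    intro k
    have : (R k).trace = ((∑ i, ∑ y, ‖v k i y‖ ^ 2 : ℝ) : ℂ) := by
      rw [hdec k, trace_sum]
      push_cast
      refine Finset.sum_congr rfl fun i _ => ?_
      rw [trace_vecMulVec, dotProduct_comm, star_dotProduct_self_eq_sum_sq]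
      push_cast
      rfl
    rw [this, Complex.ofReal_re]
  simpa only [← hdec, hk, ht] using h

/-! ### Density matrices, partial traces and channels. -/

theorem vonNeumannEntropy_nonneg {A : Type*} [Fintype A] [DecidableEq A] {ρ : Matrix A A ℂ}
    (hρ : IsDensityMatrix ρ) : 0 ≤ vonNeumannEntropy ρ := by
  obtain ⟨m, U, _, hU', hm, hM, hS⟩ := hρ.1.exists_spectral_decomposition
  have h1 : ∑ x, m x = 1 := by
    have h := hρ.2
    rw [hM, trace_mul_cycle, hU', Matrix.one_mul, trace_diagonal] at h
    exact_mod_cast h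
  rw [hS]
  refine Finset.sum_nonneg fun x _ => Real.negMulLog_nonneg (hm x) ?_
  rw [← h1]
  exact Finset.single_le_sum (fun x _ => hm x) (Finset.mem_univ x)

theorem IsDensityMatrix.partialTraceRight {A B : Type*} [Fintype A] [Fintype B]
    {τ : Matrix (A × B) (A × B) ℂ} (hτ : IsDensityMatrix τ) :
    IsDensityMatrix (partialTraceRight τ) := by
  constructor
  · have : _root_.partialTraceRight τ = ∑ j, τ.submatrix (fun i => (i, j)) (fun i => (i, j)) := by
      ext i i'
      simp [_root_.partialTraceRight, Matrix.sum_apply]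
    rw [this]
    exact posSemidef_sum _ fun j _ => hτ.1.submatrix _
  · rw [← hτ.2]
    simp [trace, _root_.partialTraceRight, Fintype.sum_prod_type]

theorem Matrix.PosSemidef.partialTraceLeft {A B : Type*} [Fintype A]
    {τ : Matrix (A × B) (A × B) ℂ} (hτ : τ.PosSemidef) : (partialTraceLeft τ).PosSemidef := by
  have : _root_.partialTraceLeft τ = ∑ i, τ.submatrix (fun j => (i, j)) (fun j => (i, j)) := by
    ext i i'
    simp [_root_.partialTraceLeft, Matrix.sum_apply]
  rw [this]
  exact posSemidef_sum _ fun j _ => hτ.submatrix _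

theorem IsDensityMatrix.partialTraceLeft {A B : Type*} [Fintype A] [Fintype B]
    {τ : Matrix (A × B) (A × B) ℂ} (hτ : IsDensityMatrix τ) :
    IsDensityMatrix (partialTraceLeft τ) := by
  refine ⟨hτ.1.partialTraceLeft, ?_⟩
  rw [← hτ.2]
  simp only [trace, diag_apply, _root_.partialTraceLeft, of_apply, Fintype.sum_prod_type]
  exact Finset.sum_comm

theorem partialTraceRight_smul {A B : Type*} [Fintype B] (c : ℂ) (τ : Matrix (A × B) (A × B) ℂ) :
    partialTraceRight (c • τ) = c • partialTraceRight τ := by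
  ext i i'
  simp [partialTraceRight, Finset.mul_sum]

theorem partialTraceLeft_smul {A B : Type*} [Fintype A] (c : ℂ) (τ : Matrix (A × B) (A × B) ℂ) :
    partialTraceLeft (c • τ) = c • partialTraceLeft τ := by
  ext i i'
  simp [partialTraceLeft, Finset.mul_sum]

theorem partialTraceLeft_sum {A B ι : Type*} [Fintype A] (s : Finset ι)
    (τ : ι → Matrix (A × B) (A × B) ℂ) :
    partialTraceLeft (∑ k ∈ s, τ k) = ∑ k ∈ s, partialTraceLeft (τ k) := by
  ext i i'
  simp only [partialTraceLeft, of_apply, Matrix.sum_apply]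
  exact Finset.sum_comm

theorem partialTraceLeft_kronecker {A B : Type*} [Fintype A] (X : Matrix A A ℂ)
    (Y : Matrix B B ℂ) : partialTraceLeft (X ⊗ₖ Y) = X.trace • Y := by
  ext i i'
  simp only [partialTraceLeft, of_apply, kroneckerMap_apply, ← Finset.sum_mul,
    Matrix.smul_apply, smul_eq_mul, trace, diag_apply]

theorem IsChannel.isDensityMatrix {B B' : Type*} [Fintype B] [DecidableEq B] [Fintype B']
    {Ω : Matrix B B ℂ →ₗ[ℂ] Matrix B' B' ℂ} (hΩ : IsChannel Ω) {ρ : Matrix B B ℂ}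
    (hρ : IsDensityMatrix ρ) : IsDensityMatrix (Ω ρ) := by
  refine ⟨?_, by rw [hΩ.2, hρ.2]⟩
  -- A one-dimensional ancilla reduces complete positivity to positivity.
  have h := hΩ.1 1 ((1 : Matrix (Fin 1) (Fin 1) ℂ) ⊗ₖ ρ) (PosSemidef.one.kronecker hρ.1)
  rw [tensorMap_kronecker] at h
  have h2 := h.submatrix fun b : B' => ((0 : Fin 1), b)
  have h3 : (LinearMap.id (R := ℂ) (1 : Matrix (Fin 1) (Fin 1) ℂ) ⊗ₖ Ω ρ).submatrix
      (fun b : B' => ((0 : Fin 1), b)) (fun b : B' => ((0 : Fin 1), b)) = Ω ρ := by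
    ext i j
    simp
  rwa [h3] at h2

theorem Matrix.PosSemidef.exists_eq_conjTranspose_mul_self {n : Type*} [Fintype n]
    [DecidableEq n] {M : Matrix n n ℂ} (hM : M.PosSemidef) : ∃ C : Matrix n n ℂ, M = Cᴴ * C := by
  obtain ⟨m, U, _, _, hm, h, _⟩ := hM.exists_spectral_decomposition
  refine ⟨diagonal (fun x => (√(m x) : ℂ)) * Uᴴ, ?_⟩
  rw [conjTranspose_mul, conjTranspose_conjTranspose, diagonal_conjTranspose, Matrix.mul_assoc,
    ← Matrix.mul_assoc (diagonal _) (diagonal _), diagonal_mul_diagonal, ← Matrix.mul_assoc]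
  conv_lhs => rw [h]
  congr 3
  ext x
  rw [Pi.star_apply, RCLike.star_def, Complex.conj_ofReal]
  exact_mod_cast (Real.mul_self_sqrt (hm x)).symm

/-! ### Measurement on the first factor. -/

/-- The partial trace is cyclic for operators acting only on the traced factor. This makes `Tr₁((CᴴC
⊗ 1)τ)` manifestly positive. -/
theorem partialTraceLeft_mul_kronecker_one_comm {A B : Type*} [Fintype A] [DecidableEq A]
    [Fintype B] [DecidableEq B] (C : Matrix A A ℂ) (τ : Matrix (A × B) (A × B) ℂ) :
    partialTraceLeft (τ * (C ⊗ₖ (1 : Matrix B B ℂ)))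
      = partialTraceLeft ((C ⊗ₖ (1 : Matrix B B ℂ)) * τ) := by
  ext j j'
  simp only [partialTraceLeft, of_apply, mul_apply, Fintype.sum_prod_type, kroneckerMap_apply,
    one_apply, mul_ite, ite_mul, mul_one, mul_zero, zero_mul, Finset.sum_ite_eq,
    Finset.sum_ite_eq', Finset.mem_univ, if_true]
  rw [Finset.sum_comm]
  exact Finset.sum_congr rfl fun _ _ => Finset.sum_congr rfl fun _ _ => mul_comm _ _

/-- The unnormalised state on the second factor after an outcome with effect `X` on the first. -/
theorem posSemidef_partialTraceLeft_kronecker_one_mul {A B : Type*} [Fintype A] [DecidableEq A]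
    [Fintype B] [DecidableEq B] {X : Matrix A A ℂ} (hX : X.PosSemidef)
    {τ : Matrix (A × B) (A × B) ℂ} (hτ : τ.PosSemidef) :
    (partialTraceLeft ((X ⊗ₖ (1 : Matrix B B ℂ)) * τ)).PosSemidef := by
  obtain ⟨C, rfl⟩ := hX.exists_eq_conjTranspose_mul_self
  have h : (Cᴴ * C) ⊗ₖ (1 : Matrix B B ℂ) = (Cᴴ ⊗ₖ 1) * (C ⊗ₖ 1) := by
    rw [← mul_kronecker_mul, Matrix.one_mul]
  rw [h, Matrix.mul_assoc, ← partialTraceLeft_mul_kronecker_one_comm]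
  have h2 : Cᴴ ⊗ₖ (1 : Matrix B B ℂ) = (C ⊗ₖ 1)ᴴ := by
    rw [conjTranspose_kronecker, conjTranspose_one]
  rw [h2]
  exact (hτ.mul_mul_conjTranspose_same _).partialTraceLeft

theorem trace_partialTraceLeft_kronecker_one_mul {A B : Type*} [Fintype A] [DecidableEq A]
    [Fintype B] [DecidableEq B] (X : Matrix A A ℂ) (τ : Matrix (A × B) (A × B) ℂ) :
    (partialTraceLeft ((X ⊗ₖ (1 : Matrix B B ℂ)) * τ)).trace
      = (X * partialTraceRight τ).trace := by
  simp only [trace, diag_apply, partialTraceLeft, partialTraceRight, of_apply, mul_apply,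
    Fintype.sum_prod_type, kroneckerMap_apply, one_apply, mul_ite, ite_mul, mul_one, mul_zero,
    zero_mul, Finset.sum_ite_eq, Finset.mem_univ, if_true, Finset.mul_sum]
  rw [Finset.sum_comm]
  exact Finset.sum_congr rfl fun _ _ => Finset.sum_comm

/-- Both sides are linear in `τ`, so it suffices to check products, hence tensor products of matrix
units. -/
theorem tensorMap_eq_sum_kronecker {A A' B B' : Type*} [Fintype A] [DecidableEq A]
    [Fintype B] [DecidableEq B] {ι : Type*} [Fintype ι]
    {Φ : Matrix A A ℂ →ₗ[ℂ] Matrix A' A' ℂ} (Ω : Matrix B B ℂ →ₗ[ℂ] Matrix B' B' ℂ)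
    {R : ι → Matrix A' A' ℂ} {X : ι → Matrix A A ℂ}
    (hΦ : ∀ ρ : Matrix A A ℂ, Φ ρ = ∑ k, (X k * ρ).trace • R k)
    (τ : Matrix (A × B) (A × B) ℂ) :
    tensorMap Φ Ω τ
      = ∑ k, R k ⊗ₖ Ω (partialTraceLeft ((X k ⊗ₖ (1 : Matrix B B ℂ)) * τ)) := by
  have hkron : ∀ (P : Matrix A A ℂ) (Q : Matrix B B ℂ), tensorMap Φ Ω (P ⊗ₖ Q)
      = ∑ k, R k ⊗ₖ Ω (partialTraceLeft ((X k ⊗ₖ (1 : Matrix B B ℂ)) * (P ⊗ₖ Q))) := by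
    intro P Q
    rw [tensorMap_kronecker, hΦ]
    simp only [← mul_kronecker_mul, Matrix.one_mul, partialTraceLeft_kronecker, map_smul,
      kronecker_smul, ← smul_kronecker]
    ext p q
    simp only [Matrix.sum_apply, kroneckerMap_apply, Finset.sum_mul]
  have hτ : τ = ∑ x, ∑ y, τ x y • (Matrix.single x.1 y.1 (1 : ℂ) ⊗ₖ Matrix.single x.2 y.2 1) := by
    conv_lhs => rw [matrix_eq_sum_single τ]
    simp only [single_kronecker_single, mul_one, smul_single, smul_eq_mul]
  rw [hτ]
  simp only [map_sum, map_smul, hkron, Finset.mul_sum, Matrix.mul_smul, partialTraceLeft_sum,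
    partialTraceLeft_smul]
  ext p q
  simp only [Matrix.sum_apply, Matrix.smul_apply, kroneckerMap_apply, Finset.mul_sum, smul_eq_mul]
  conv_rhs => rw [Finset.sum_comm]
  refine Finset.sum_congr rfl fun x _ => ?_
  conv_rhs => rw [Finset.sum_comm]
  exact Finset.sum_congr rfl fun y _ => Finset.sum_congr rfl fun k _ => mul_left_comm _ _ _

/-! ### Ensembles and the infimum. -/

/-- An arbitrary finite index type admits ensembles indexed by pairs. Preservation of states bounds
the set below by `0`, as `sInf` requires. -/
theorem minAverageEntropy_le {A A' ι : Type*} [Fintype A] [Fintype A'] [DecidableEq A']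
    [Fintype ι] {Ω : Matrix A A ℂ →ₗ[ℂ] Matrix A' A' ℂ}
    (hΩ : ∀ ρ, IsDensityMatrix ρ → IsDensityMatrix (Ω ρ)) {ρ : Matrix A A ℂ}
    (p : ι → ℝ) (σ : ι → Matrix A A ℂ) (hp : ∀ k, 0 ≤ p k) (hp1 : ∑ k, p k = 1)
    (hσ : ∀ k, IsDensityMatrix (σ k)) (hρ : ∑ k, (p k : ℂ) • σ k = ρ) :
    minAverageEntropy Ω ρ ≤ ∑ k, p k * vonNeumannEntropy (Ω (σ k)) := by
  let e := (Fintype.equivFin ι).symm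
  refine csInf_le ⟨0, ?_⟩ ⟨Fintype.card ι, p ∘ e, σ ∘ e, fun k => hp _, ?_, fun k => hσ _, ?_, ?_⟩
  · rintro s ⟨n, p, σ, hp, -, hσ, -, rfl⟩
    exact Finset.sum_nonneg fun k _ =>
      mul_nonneg (hp k) (vonNeumannEntropy_nonneg (hΩ _ (hσ k)))
  · rw [← hp1]
    exact e.sum_comp p
  · rw [← hρ]
    exact e.sum_comp fun k => (p k : ℂ) • σ k
  · exact (e.sum_comp fun k => p k * vonNeumannEntropy (Ω (σ k))).symm

theorem IsEntanglementBreaking.isDensityMatrix {A A' : Type*} [Fintype A] [DecidableEq A]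
    [Fintype A'] {Φ : Matrix A A ℂ →ₗ[ℂ] Matrix A' A' ℂ} (hΦ : IsEntanglementBreaking Φ)
    {ρ : Matrix A A ℂ} (hρ : IsDensityMatrix ρ) : IsDensityMatrix (Φ ρ) := by
  obtain ⟨K, R, X, hR, hX, hX1, h⟩ := hΦ
  rw [h]
  constructor
  · refine posSemidef_sum _ fun k _ => (hR k).1.smul ?_
    obtain ⟨C, hC⟩ := (hX k).exists_eq_conjTranspose_mul_self
    rw [hC, ← trace_mul_cycle]
    exact (hρ.1.mul_mul_conjTranspose_same C).trace_nonneg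
  · simp only [trace_sum, trace_smul, (hR _).2, smul_eq_mul, mul_one]
    rw [← trace_sum, ← Finset.sum_mul, hX1, Matrix.one_mul, hρ.2]

/-- The entropy of the output of `Φ ⊗ Ω` with `Φ` entanglement-breaking dominates the entropy of
the output of `Φ` plus the average output entropy of `Ω` over an ensemble for the second marginal. -/
theorem exists_ensemble_entropy_add_le {A A' B B' : Type*}
    [Fintype A] [DecidableEq A] [Fintype A'] [DecidableEq A']
    [Fintype B] [DecidableEq B] [Fintype B'] [DecidableEq B'] {ι : Type*} [Fintype ι]
    {Φ : Matrix A A ℂ →ₗ[ℂ] Matrix A' A' ℂ} {Ω : Matrix B B ℂ →ₗ[ℂ] Matrix B' B' ℂ}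
    (hΩ : IsChannel Ω) {R : ι → Matrix A' A' ℂ} {X : ι → Matrix A A ℂ}
    (hR : ∀ k, IsDensityMatrix (R k)) (hX : ∀ k, (X k).PosSemidef) (hX1 : ∑ k, X k = 1)
    (hΦ : ∀ ρ : Matrix A A ℂ, Φ ρ = ∑ k, (X k * ρ).trace • R k)
    {τ : Matrix (A × B) (A × B) ℂ} (hτ : IsDensityMatrix τ) :
    ∃ (q : ι → ℝ) (σ : ι → Matrix B B ℂ), (∀ k, 0 ≤ q k) ∧ ∑ k, q k = 1 ∧
      (∀ k, IsDensityMatrix (σ k)) ∧ ∑ k, (q k : ℂ) • σ k = partialTraceLeft τ ∧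
      vonNeumannEntropy (Φ (partialTraceRight τ)) + ∑ k, q k * vonNeumannEntropy (Ω (σ k))
        ≤ vonNeumannEntropy (tensorMap Φ Ω τ) := by
  set Y : ι → Matrix B B ℂ := fun k => partialTraceLeft ((X k ⊗ₖ (1 : Matrix B B ℂ)) * τ) with hY
  have hYpsd : ∀ k, (Y k).PosSemidef := fun k =>
    posSemidef_partialTraceLeft_kronecker_one_mul (hX k) hτ.1
  have hYsum : ∑ k, Y k = partialTraceLeft τ := by
    rw [← partialTraceLeft_sum, ← Finset.sum_mul]
    congr 1
    have : ∑ k, X k ⊗ₖ (1 : Matrix B B ℂ) = 1 := by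
      rw [← one_kronecker_one, ← hX1]
      ext p q
      simp only [Matrix.sum_apply, kroneckerMap_apply, Finset.sum_mul]
    rw [this, Matrix.one_mul]
  have hq : ∀ k, ((Y k).trace.re : ℂ) = (Y k).trace := fun k =>
    (Complex.eq_re_of_ofReal_le (hYpsd k).trace_nonneg).symm
  have hq0 : ∀ k, 0 ≤ (Y k).trace.re := fun k => (Complex.le_def.1 (hYpsd k).trace_nonneg).1
  have hσ : ∀ k, ∃ σ, IsDensityMatrix σ ∧ Y k = (Y k).trace • σ := by
    intro k
    by_cases h0 : (Y k).trace = 0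
    -- An outcome of probability zero has `Y k = 0`, so any state serves.
    · exact ⟨partialTraceLeft τ, hτ.partialTraceLeft, by
        rw [h0, zero_smul, (hYpsd k).trace_eq_zero_iff.1 h0]⟩
    · refine ⟨(Y k).trace⁻¹ • Y k, ⟨(hYpsd k).smul ?_, ?_⟩, ?_⟩
      · rw [← hq, ← Complex.ofReal_inv]
        exact_mod_cast inv_nonneg.2 (hq0 k)
      · rw [trace_smul, smul_eq_mul, inv_mul_cancel₀ h0]
      · rw [smul_smul, mul_inv_cancel₀ h0, one_smul]
  choose σ hσd hσY using hσ
  refine ⟨fun k => (Y k).trace.re, σ, hq0, ?_, hσd, ?_, ?_⟩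
  · have h := hτ.partialTraceLeft.2
    rw [← hYsum, trace_sum] at h
    rw [← Complex.re_sum, h, Complex.one_re]
  · simp only [hq, ← hσY, hYsum]
  · have h := vonNeumannEntropy_sum_kronecker_ge (fun k => (Y k).trace • R k) (fun k => Ω (σ k))
      (fun k => (hR k).1.smul (hYpsd k).trace_nonneg) (fun k => hΩ.isDensityMatrix (hσd k))
    have h1 : ∑ k, (Y k).trace • R k = Φ (partialTraceRight τ) := by
      rw [hΦ]
      simp only [hY, trace_partialTraceLeft_kronecker_one_mul]
    have h2 : ∑ k, ((Y k).trace • R k) ⊗ₖ Ω (σ k) = tensorMap Φ Ω τ := by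
      rw [tensorMap_eq_sum_kronecker Ω hΦ]
      refine Finset.sum_congr rfl fun k _ => ?_
      change _ = R k ⊗ₖ Ω (Y k)
      rw [smul_kronecker, ← kronecker_smul, ← map_smul, ← hσY]
    simpa only [h1, h2, trace_smul, (hR _).2, smul_eq_mul, mul_one] using h

theorem lemma3 {A A' B B' : Type*}
    [Fintype A] [DecidableEq A] [Fintype A'] [DecidableEq A']
    [Fintype B] [DecidableEq B] [Fintype B'] [DecidableEq B']
    (Φ : Matrix A A ℂ →ₗ[ℂ] Matrix A' A' ℂ) (hΦ : IsEntanglementBreaking Φ)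
    (Ω : Matrix B B ℂ →ₗ[ℂ] Matrix B' B' ℂ) (hΩ : IsChannel Ω)
    (τ : Matrix (A × B) (A × B) ℂ) (hτ : IsDensityMatrix τ) :
    minAverageEntropy (tensorMap Φ Ω) τ ≥
      minAverageEntropy Φ (partialTraceRight τ) + minAverageEntropy Ω (partialTraceLeft τ) := by
  -- The one-element ensemble `τ` shows that the set is nonempty.
  refine le_csInf ⟨_, 1, fun _ => 1, fun _ => τ, by simp, by simp, fun _ => hτ, by simp, rfl⟩ ?_
  rintro s ⟨n, p, ρ, hp, hp1, hρ, hρτ, rfl⟩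
  obtain ⟨K, R, X, hR, hX, hX1, hΦ'⟩ := id hΦ
  choose q σ hq hq1 hσ hσρ hle using fun l =>
    exists_ensemble_entropy_add_le hΩ hR hX hX1 hΦ' (hρ l)
  have h1 := minAverageEntropy_le (fun _ h => hΦ.isDensityMatrix h) (ρ := partialTraceRight τ) p
    (fun l => partialTraceRight (ρ l)) hp hp1 (fun l => (hρ l).partialTraceRight) (by
      rw [← hρτ, partialTraceRight_sum]
      simp only [partialTraceRight_smul])
  -- The ensembles obtained from each `ρ l` are merged, with weights `p l * q l k`.
  have h2 := minAverageEntropy_le (fun _ h => hΩ.isDensityMatrix h) (ρ := partialTraceLeft τ)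
    (fun x : Fin n × Fin K => p x.1 * q x.1 x.2) (fun x => σ x.1 x.2)
    (fun x => mul_nonneg (hp _) (hq _ _))
    (by simp only [Fintype.sum_prod_type, ← Finset.mul_sum, hq1, mul_one, hp1])
    (fun x => hσ _ _) (by
      rw [← hρτ, partialTraceLeft_sum]
      simp only [Fintype.sum_prod_type, partialTraceLeft_smul, Complex.ofReal_mul, mul_smul,
        ← Finset.smul_sum, hσρ])
  refine (add_le_add h1 h2).trans ?_
  rw [Fintype.sum_prod_type, ← Finset.sum_add_distrib]
  refine Finset.sum_le_sum fun l _ => ?_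
  simp only [mul_assoc, ← Finset.mul_sum, ← mul_add]
  exact mul_le_mul_of_nonneg_left (hle l) (hp l)
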